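/- There is a $\mathbf 0'$-computable colouring $I:\omega\to\{1,2,3\}$ (that is, $I$ is computable from the halting set) such that for every colouring $C:\omega\to\{1,2\}$, computable or not, there is an infinite set $G\subseteq\omega$ that is homogeneous for $C$ (that is, $C$ is constant on $G$) and that does not compute any infinite set homogeneous for $I$. In particular, for no colouring $C:\omega\to\{1,2\}$ is the set of infinite homogeneous sets of $I$ Muchnik reducible to the set of infinite homogeneous sets of $C$. Here a class $P\subseteq 2^\omega$ is Muchnik reducible to a class $Q\subseteq 2^\omega$ if every member of $Q$ computes (as a Turing oracle) some member of $P$. -/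

import Mathlib

/-- The characteristic function of a set of natural numbers, as a (total) oracle. -/
noncomputable def charOracle (A : Set ℕ) : ℕ →. ℕ :=
  fun n => Part.some (A.indicator (fun _ => 1) n)

/-- `A.ComputedBy B`: the set `A` is Turing reducible to the set `B`, that is, `B` computes `A`. -/
def Set.ComputedBy (A B : Set ℕ) : Prop :=
  TuringReducible (charOracle A) (charOracle B)

/-- The halting set: `n` is in it iff the `n`-th partial computable function halts on input `n`.
Its Turing degree is `0'`. -/
def haltingSet : Set ℕ :=
  {n | ((Denumerable.ofNat Nat.Partrec.Code n).eval n).Dom}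

/-- An instance of `RT^1_k`: a colouring of the natural numbers with `k` colours. -/
abbrev RT1Instance (k : ℕ) : Type := ℕ → Fin k

/-- A colouring is `0'`-computable iff it is computable from the halting set. -/
def RT1Instance.ZeroJumpComputable {k : ℕ} (I : RT1Instance k) : Prop :=
  ComputableIn {charOracle haltingSet} I

/-- A set is homogeneous for a colouring iff the colouring is constant on it. -/
def RT1Instance.Homogeneous {k : ℕ} (I : RT1Instance k) (H : Set ℕ) : Prop :=
  ∀ x ∈ H, ∀ y ∈ H, I x = I y

/-- The non-trivial solutions of an instance: its infinite homogeneous sets. -/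
def RT1Instance.solutions {k : ℕ} (I : RT1Instance k) : Set (Set ℕ) :=
  {H | H.Infinite ∧ I.Homogeneous H}

/-- `P` is Muchnik reducible to `Q`: every member of `Q` computes some member of `P`. -/
def MuchnikReducible (P Q : Set (Set ℕ)) : Prop :=
  ∀ G ∈ Q, ∃ H ∈ P, H.ComputedBy G

/-!
Take `I` to be sufficiently generic: each Σ₁ set of strings either contains an initial segment of
`I` or is disjoint from the extensions of some initial segment. The halting set decides whether a
string has an extension in a given Σ₁ set, so such an `I` can be found by finite extensions
computably in the halting set (`exists_generic_zeroJumpComputable`).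

Given `C`, two sets `G 0` and `G 1`, one for each colour of `C`, are built by a variant of Mathias
forcing. An infinite homogeneous set of `I` avoids two of the three colours. So if both `G 0` and
`G 1` computed such sets `H 0` and `H 1`, some colour `i` would occur in neither of them, and it
is enough to ensure, for any two Turing functionals `Φ 0`, `Φ 1` and any colour `i`, that for some
`j` the set computed from `G j` by `Φ j` contains a number of colour `i` or is finite
(`Condition.exists_settles`, `exists_forall_not_computedBy`).

A condition consists of a finite initial segment of each `G j`, and of a nonempty `Π⁰₁` class of
infinite reservoirs, from which further elements may be taken. Using a class of reservoirs in
place of a single one keeps all questions about a condition Σ₁ without any relativization: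
consider the strings such that, for every reservoir in the class and every splitting of it into
two parts `Z 0` and `Z 1`, some `Φ j` enumerates from the stem and a finite subset of `Z j` a
number to which the string gives the colour `i`. By compactness, these strings form a Σ₁ set
(`SigmaOne.forall_bounded`), to which the genericity of `I` applies
(`RT1Instance.Generic.dichotomy`). If an initial segment of `I` belongs to the set, the splitting
of a reservoir according to `C` provides an extension of one of the stems that enumerates a number
of colour `i`. Otherwise, by compactness again, some splitting of some reservoir yields no number
beyond a bound; the splittings of this kind form a `Π⁰₁` class, which can be thinned out so that
one of the parts is always infinite, and this part becomes the new reservoir.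

If some condition has only reservoirs that are, up to finitely many elements, of a single colour
for `C`, both `G 0` and `G 1` are built from such reservoirs; otherwise they can be made infinite
with one set for each colour (`RT1Instance.Generic.exists_solution`).
-/

/-! ### Σ₁ predicates -/

/-- A predicate is `SigmaOne` if it is of the form `∃ k, R a k` with `R` primitive recursive. These
are the recursively enumerable predicates, in a normal form in which their closure properties follow
from those of the primitive recursive predicates. -/
def SigmaOne {α : Type} [Primcodable α] (p : α → Prop) : Prop :=
  ∃ R : α → ℕ → Prop, PrimrecRel R ∧ ∀ a, p a ↔ ∃ k, R a k

namespace SigmaOne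

variable {α β : Type} [Primcodable α] [Primcodable β] {p q : α → Prop}

theorem of_eq (hp : SigmaOne p) (h : ∀ a, p a ↔ q a) : SigmaOne q :=
  (funext fun a => propext (h a) : p = q) ▸ hp

theorem of_primrecPred (hp : PrimrecPred p) : SigmaOne p :=
  ⟨fun a _ => p a, hp.comp Primrec.fst, fun a => by simp⟩

theorem comp {p : β → Prop} (hp : SigmaOne p) {f : α → β} (hf : Primrec f) :
    SigmaOne fun a => p (f a) := by
  obtain ⟨R, hR, h⟩ := hp
  exact ⟨fun a k => R (f a) k, hR.comp (hf.comp Primrec.fst) Primrec.snd, fun a => h _⟩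

/-- The stages of a `SigmaOne` predicate can be taken increasing. -/
theorem exists_monotone (hp : SigmaOne p) : ∃ R : α → ℕ → Prop, PrimrecRel R ∧
    (∀ a k l, k ≤ l → R a k → R a l) ∧ ∀ a, p a ↔ ∃ k, R a k := by
  obtain ⟨R, hR, h⟩ := hp
  refine ⟨fun a k => ∃ j < k, R a j, ?_, ?_, ?_⟩
  · exact ((PrimrecRel.exists_mem_list hR.swap).comp (Primrec.list_range.comp Primrec.snd)
      Primrec.fst).of_eq fun x => by simp [Function.swap]
  · rintro a k l hkl ⟨j, hj, hR⟩
    exact ⟨j, hj.trans_le hkl, hR⟩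
  · intro a
    rw [h]
    exact ⟨fun ⟨k, hk⟩ => ⟨k + 1, k, k.lt_succ_self, hk⟩, fun ⟨_, k, _, hk⟩ => ⟨k, hk⟩⟩

theorem and (hp : SigmaOne p) (hq : SigmaOne q) : SigmaOne fun a => p a ∧ q a := by
  obtain ⟨R, hR, hRm, h⟩ := hp.exists_monotone
  obtain ⟨S, hS, hSm, h'⟩ := hq.exists_monotone
  refine ⟨fun a k => R a k ∧ S a k, PrimrecPred.and hR hS, fun a => ?_⟩
  simp only
  rw [h, h']
  exact ⟨fun ⟨⟨k, hk⟩, ⟨l, hl⟩⟩ => ⟨max k l, hRm _ _ _ (le_max_left _ _) hk,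
    hSm _ _ _ (le_max_right _ _) hl⟩, fun ⟨k, hk, hl⟩ => ⟨⟨k, hk⟩, ⟨k, hl⟩⟩⟩

theorem or (hp : SigmaOne p) (hq : SigmaOne q) : SigmaOne fun a => p a ∨ q a := by
  obtain ⟨R, hR, h⟩ := hp
  obtain ⟨S, hS, h'⟩ := hq
  refine ⟨fun a k => R a k ∨ S a k, PrimrecPred.or hR hS, fun a => ?_⟩
  simp only
  rw [h, h', exists_or]

theorem exists_snd {p : α × β → Prop} (hp : SigmaOne p) : SigmaOne fun a => ∃ b, p (a, b) := by
  obtain ⟨R, hR, h⟩ := hp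
  -- The stage codes a pair of a candidate for `b` and a stage for it.
  have hpr : Primrec fun x : α × ℕ =>
      (Encodable.decode (α := β) x.2.unpair.1).map fun b => ((x.1, b), x.2.unpair.2) :=
    Primrec.option_map (Primrec.decode.comp (Primrec.fst.comp (Primrec.unpair.comp Primrec.snd)))
      (((Primrec.fst.comp Primrec.fst).pair Primrec.snd).pair
        (Primrec.snd.comp (Primrec.unpair.comp (Primrec.snd.comp Primrec.fst)))).to₂
  classical
  refine ⟨fun a k => ((Encodable.decode (α := β) k.unpair.1).map fun b =>
      ((a, b), k.unpair.2)).any (fun c => decide (R c.1 c.2)) = true, ?_, ?_⟩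
  · have h1 : Primrec fun c : (α × β) × ℕ => decide (R c.1 c.2) := PrimrecPred.decide hR
    have h2 : Primrec fun o : Option ((α × β) × ℕ) => o.any fun c => decide (R c.1 c.2) :=
      (Primrec.option_casesOn Primrec.id (Primrec.const false) (h1.comp Primrec.snd).to₂).of_eq
        fun o => by cases o <;> rfl
    exact Primrec.eq.comp (h2.comp hpr) (Primrec.const true)
  · intro a
    constructor
    · rintro ⟨b, hb⟩
      obtain ⟨k, hk⟩ := (h _).1 hb
      exact ⟨Nat.pair (Encodable.encode b) k, by simpa using hk⟩
    · rintro ⟨k, hk⟩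
      rcases hd : (Encodable.decode k.unpair.1 : Option β) with _ | b
      · simp [hd] at hk
      · exact ⟨b, (h _).2 ⟨k.unpair.2, by simpa [hd] using hk⟩⟩

theorem forall_mem_list {p : α × β → Prop} (hp : SigmaOne p) {f : α → List β} (hf : Primrec f) :
    SigmaOne fun a => ∀ b ∈ f a, p (a, b) := by
  obtain ⟨R, hR, hRm, h⟩ := hp.exists_monotone
  refine ⟨fun a k => ∀ b ∈ f a, R (a, b) k, ?_, fun a => ?_⟩
  · have h1 : PrimrecRel fun (b : β) (x : α × ℕ) => R (x.1, b) x.2 :=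
      hR.comp ((Primrec.fst.comp Primrec.snd).pair Primrec.fst) (Primrec.snd.comp Primrec.snd)
    exact (PrimrecRel.forall_mem_list h1).comp (hf.comp Primrec.fst) Primrec.id
  · simp only [h]
    constructor
    · generalize f a = l
      intro hb
      induction l with
      | nil => exact ⟨0, by simp⟩
      | cons b l ih =>
        obtain ⟨k, hk⟩ := ih fun b hb' => hb b (List.mem_cons_of_mem _ hb')
        obtain ⟨j, hj⟩ := hb b List.mem_cons_self
        refine ⟨max j k, fun c hc => ?_⟩
        rcases List.mem_cons.1 hc with rfl | hc
        · exact hRm _ _ _ (le_max_left _ _) hj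
        · exact hRm _ _ _ (le_max_right _ _) (hk c hc)
    · rintro ⟨k, hk⟩ b hb
      exact ⟨k, hk b hb⟩

/-- The `e`-th partial recursive function, as a relation in `e`, argument and value. -/
theorem eval_graph : SigmaOne fun x : (Nat.Partrec.Code × ℕ) × ℕ => x.2 ∈ x.1.1.eval x.1.2 := by
  refine ⟨fun x k => Nat.Partrec.Code.evaln k x.1.1 x.1.2 = some x.2, ?_, fun x => ?_⟩
  · have h : Primrec fun y : ((Nat.Partrec.Code × ℕ) × ℕ) × ℕ =>
        Nat.Partrec.Code.evaln y.2 y.1.1.1 y.1.1.2 :=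
      Nat.Partrec.Code.primrec_evaln.comp ((Primrec.snd.pair
        (Primrec.fst.comp (Primrec.fst.comp Primrec.fst))).pair
        (Primrec.snd.comp (Primrec.fst.comp Primrec.fst)))
    exact Primrec.eq.comp h (Primrec.option_some.comp (Primrec.snd.comp Primrec.fst))
  · exact Nat.Partrec.Code.evaln_complete

theorem graph_of_partrec {f : α →. β} (hf : Partrec f) : SigmaOne fun x : α × β => x.2 ∈ f x.1 := by
  obtain ⟨c, hc⟩ := Nat.Partrec.Code.exists_code.1 hf
  refine (eval_graph.comp (((Primrec.const c).pair (Primrec.encode.comp Primrec.fst)).pair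
    (Primrec.encode.comp Primrec.snd))).of_eq fun x => ?_
  simp [hc]

theorem rePred (hp : SigmaOne p) : REPred p := by
  classical
  obtain ⟨R, hR, h⟩ := hp
  refine (Partrec.dom_re (Partrec.rfind (p := fun a k => Part.some (decide (R a k)))
    (Computable.partrec (PrimrecRel.decide hR).to_comp).to₂)).of_eq fun a => ?_
  rw [h]
  refine Nat.rfind_dom.trans ?_
  simp

/-- Every `SigmaOne` predicate is the domain of some partial recursive function. -/
theorem exists_code (hp : SigmaOne p) :
    ∃ c : Nat.Partrec.Code, ∀ a, p a ↔ (c.eval (Encodable.encode a)).Dom := by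
  obtain ⟨c, hc⟩ := Nat.Partrec.Code.exists_code.1 hp.rePred
  exact ⟨c, fun a => by simp [hc, Part.assert]⟩

end SigmaOne

/-! ### The use principle -/

/-- The string of the first `k` values of a sequence. -/
def initSeg {α : Type} (x : ℕ → α) (k : ℕ) : List α := (List.range k).map x

section initSeg

variable {α : Type} (x : ℕ → α)

@[simp] theorem length_initSeg (k : ℕ) : (initSeg x k).length = k := by simp [initSeg]

theorem getElem?_initSeg (k m : ℕ) : (initSeg x k)[m]? = if m < k then some (x m) else none := by
  split_ifs with h <;> simp [initSeg, h]

theorem getElem?_initSeg_eq_some {k m : ℕ} {a : α} :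
    (initSeg x k)[m]? = some a ↔ m < k ∧ x m = a := by
  rw [getElem?_initSeg]
  split_ifs with h <;> simp [h]

theorem take_initSeg (j k : ℕ) : (initSeg x k).take j = initSeg x (min j k) := by
  simp [initSeg, ← List.map_take, List.take_range]

theorem initSeg_prefix {j k : ℕ} (h : j ≤ k) : initSeg x j <+: initSeg x k := by
  rw [List.prefix_iff_eq_take, take_initSeg]
  simp [h]

theorem initSeg_succ (k : ℕ) : initSeg x (k + 1) = initSeg x k ++ [x k] := by
  simp [initSeg, List.range_succ]

end initSeg

theorem List.IsPrefix.getElem?_eq_some {α : Type} {σ τ : List α} (h : σ <+: τ) {m : ℕ} {a : α}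
    (hm : σ[m]? = some a) : τ[m]? = some a := by
  obtain ⟨υ, rfl⟩ := h
  rw [List.getElem?_append_left (List.getElem?_eq_some_iff.1 hm).1, hm]

/-- A Turing functional: a partial recursive function of a string, thought of as a finite piece of
the oracle, and of an argument, such that extending the string preserves convergence and values. -/
structure Functional where
  /-- The value computed from a string and an argument. -/
  toFun : List Bool → ℕ →. ℕ
  partrec : Partrec₂ toFun
  mono : ∀ {σ τ n y}, σ <+: τ → y ∈ toFun σ n → y ∈ toFun τ n

/-- `Φ.Computes g f`: with oracle `g`, the functional `Φ` computes the partial function `f`. -/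
def Functional.Computes (Φ : Functional) (g : ℕ → Bool) (f : ℕ →. ℕ) : Prop :=
  ∀ n y, y ∈ f n ↔ ∃ k, y ∈ Φ.toFun (initSeg g k) n

theorem Functional.Computes.common {Φ : Functional} {g : ℕ → Bool} {f : ℕ →. ℕ}
    (h : Φ.Computes g f) {n y : ℕ} (hy : y ∈ f n) :
    ∃ k, ∀ l, k ≤ l → y ∈ Φ.toFun (initSeg g l) n := by
  obtain ⟨k, hk⟩ := (h n y).1 hy
  exact ⟨k, fun l hl => Φ.mono (initSeg_prefix g hl) hk⟩

namespace Functional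

/-- The functional that ignores its oracle. -/
def ofPartrec (f : ℕ →. ℕ) (hf : Nat.Partrec f) : Functional where
  toFun _ n := f n
  partrec := (Partrec.nat_iff.2 hf).comp Computable.snd
  mono _ h := h

theorem computes_ofPartrec (f : ℕ →. ℕ) (hf : Nat.Partrec f) (g : ℕ → Bool) :
    (ofPartrec f hf).Computes g f := fun _ _ => by simp [ofPartrec]

/-- The functional that looks up the oracle. -/
def query : Functional where
  toFun σ n := ((σ[n]?).map Bool.toNat : Option ℕ)
  partrec := by
    refine Computable.ofOption (Primrec.to_comp ?_)
    exact Primrec.option_map Primrec.list_getElem?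
      ((Primrec.dom_bool Bool.toNat).comp Primrec.snd).to₂
  mono := by
    intro σ τ n y h hy
    simp only [Part.mem_coe, Option.mem_def, Option.map_eq_some_iff] at hy ⊢
    obtain ⟨b, hb, rfl⟩ := hy
    exact ⟨b, h.getElem?_eq_some hb, rfl⟩

theorem computes_query (g : ℕ → Bool) : query.Computes g fun n => Part.some (g n).toNat := by
  intro n y
  simp only [query, Part.mem_some_iff, Part.mem_coe, Option.mem_def, Option.map_eq_some_iff,
    getElem?_initSeg_eq_some]
  constructor
  · rintro rfl
    exact ⟨n + 1, _, ⟨n.lt_succ_self, rfl⟩, rfl⟩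
  · rintro ⟨k, b, ⟨_, rfl⟩, rfl⟩
    rfl

/-- Pairing of functionals. -/
def pair (Φ Ψ : Functional) : Functional where
  toFun σ n := (Φ.toFun σ n).bind fun a => (Ψ.toFun σ n).map fun b => Nat.pair a b
  partrec := by
    refine Partrec.bind (f := fun x : List Bool × ℕ => Φ.toFun x.1 x.2)
      (g := fun x a => (Ψ.toFun x.1 x.2).map fun b => Nat.pair a b) Φ.partrec ?_
    exact Partrec.map (f := fun x : (List Bool × ℕ) × ℕ => Ψ.toFun x.1.1 x.1.2)
      (Ψ.partrec.comp (Computable.fst.comp Computable.fst) (Computable.snd.comp Computable.fst))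
      (Primrec₂.natPair.comp (Primrec.snd.comp Primrec.fst) Primrec.snd).to_comp.to₂
  mono := by
    intro σ τ n y h hy
    simp only [Part.mem_bind_iff, Part.mem_map_iff] at hy ⊢
    obtain ⟨a, ha, b, hb, rfl⟩ := hy
    exact ⟨a, Φ.mono h ha, b, Ψ.mono h hb, rfl⟩

theorem Computes.pair {Φ Ψ : Functional} {g : ℕ → Bool} {f h : ℕ →. ℕ} (hf : Φ.Computes g f)
    (hh : Ψ.Computes g h) : (Φ.pair Ψ).Computes g fun n => Nat.pair <$> f n <*> h n := by
  intro n y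
  have : (y ∈ (Nat.pair <$> f n <*> h n : Part ℕ)) ↔ ∃ a ∈ f n, ∃ b ∈ h n, Nat.pair a b = y := by
    simp [Seq.seq]
  rw [this]
  simp only [Functional.pair, Part.mem_bind_iff, Part.mem_map_iff]
  constructor
  · rintro ⟨a, ha, b, hb, rfl⟩
    obtain ⟨k, hk⟩ := hf.common ha
    obtain ⟨l, hl⟩ := hh.common hb
    exact ⟨max k l, a, hk _ (le_max_left _ _), b, hl _ (le_max_right _ _), rfl⟩
  · rintro ⟨k, a, ha, b, hb, rfl⟩
    exact ⟨a, (hf _ _).2 ⟨k, ha⟩, b, (hh _ _).2 ⟨k, hb⟩, rfl⟩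

/-- Composition of functionals with the same oracle. -/
def comp (Φ Ψ : Functional) : Functional where
  toFun σ n := (Ψ.toFun σ n).bind fun a => Φ.toFun σ a
  partrec := Partrec.bind (f := fun x : List Bool × ℕ => Ψ.toFun x.1 x.2)
    (g := fun x a => Φ.toFun x.1 a) Ψ.partrec
    (Φ.partrec.comp (Computable.fst.comp Computable.fst) Computable.snd)
  mono := by
    intro σ τ n y h hy
    simp only [Part.mem_bind_iff] at hy ⊢
    obtain ⟨a, ha, hy⟩ := hy
    exact ⟨a, Ψ.mono h ha, Φ.mono h hy⟩

theorem Computes.comp {Φ Ψ : Functional} {g : ℕ → Bool} {f h : ℕ →. ℕ} (hf : Φ.Computes g f)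
    (hh : Ψ.Computes g h) : (Φ.comp Ψ).Computes g fun n => h n >>= f := by
  intro n y
  refine (Part.mem_bind_iff (f := h n) (g := f)).trans ?_
  simp only [Functional.comp, Part.mem_bind_iff]
  constructor
  · rintro ⟨a, ha, hy⟩
    obtain ⟨k, hk⟩ := hh.common ha
    obtain ⟨l, hl⟩ := hf.common hy
    exact ⟨max k l, a, hk _ (le_max_left _ _), hl _ (le_max_right _ _)⟩
  · rintro ⟨k, a, ha, hy⟩
    exact ⟨a, (hh _ _).2 ⟨k, ha⟩, (hf _ _).2 ⟨k, hy⟩⟩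

/-- Primitive recursion of functionals. -/
def prec (Φ Ψ : Functional) : Functional where
  toFun σ p := Nat.rec (motive := fun _ => Part ℕ) (Φ.toFun σ p.unpair.1)
    (fun m IH => IH.bind fun i => Ψ.toFun σ (Nat.pair p.unpair.1 (Nat.pair m i))) p.unpair.2
  partrec := by
    have hu : Computable fun x : List Bool × ℕ => x.2.unpair :=
      (Primrec.unpair.comp Primrec.snd).to_comp
    refine Partrec.nat_rec (f := fun x : List Bool × ℕ => x.2.unpair.2)
      (g := fun x => Φ.toFun x.1 x.2.unpair.1)
      (h := fun x q => Ψ.toFun x.1 (Nat.pair x.2.unpair.1 (Nat.pair q.1 q.2)))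
      (Computable.snd.comp hu) (Φ.partrec.comp Computable.fst (Computable.fst.comp hu)) ?_
    refine Ψ.partrec.comp (Computable.fst.comp Computable.fst) ?_
    exact Primrec₂.natPair.to_comp.comp (Computable.fst.comp (hu.comp Computable.fst))
      (Primrec₂.natPair.to_comp.comp (Computable.fst.comp Computable.snd)
        (Computable.snd.comp Computable.snd))
  mono := by
    intro σ τ n y h
    generalize n.unpair.2 = m
    induction m generalizing y with
    | zero => exact Φ.mono h
    | succ m ih =>
      simp only [Part.mem_bind_iff]
      rintro ⟨i, hi, hy⟩
      exact ⟨i, ih hi, Ψ.mono h hy⟩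

theorem Computes.prec {Φ Ψ : Functional} {g : ℕ → Bool} {f h : ℕ →. ℕ} (hf : Φ.Computes g f)
    (hh : Ψ.Computes g h) : (Φ.prec Ψ).Computes g fun p =>
      (Nat.rec (motive := fun _ => Part ℕ) (f p.unpair.1)
        (fun y IH => IH.bind fun i => h (Nat.pair p.unpair.1 (Nat.pair y i))) p.unpair.2) := by
  intro n y
  simp only [Functional.prec]
  generalize n.unpair.2 = m
  generalize n.unpair.1 = a
  induction m generalizing y with
  | zero => exact hf a y
  | succ m ih =>
    simp only [Part.mem_bind_iff] at ih ⊢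
    constructor
    · rintro ⟨i, hi, hy⟩
      obtain ⟨k, hk⟩ := (ih i).1 hi
      obtain ⟨l, hl⟩ := hh.common hy
      refine ⟨max k l, i, ?_, hl _ (le_max_right _ _)⟩
      have := (Φ.prec Ψ).mono (n := Nat.pair a m) (initSeg_prefix g (le_max_left k l))
        (by simpa [Functional.prec] using hk)
      simpa [Functional.prec] using this
    · rintro ⟨k, i, hi, hy⟩
      exact ⟨i, (ih i).2 ⟨k, hi⟩, (hh _ _).2 ⟨k, hy⟩⟩

/-- Unbounded search with a functional. -/
def rfind (Φ : Functional) : Functional where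
  toFun σ a := Nat.rfind fun n => (Φ.toFun σ (Nat.pair a n)).map fun m => decide (m = 0)
  partrec := by
    refine Partrec.rfind (p := fun (x : List Bool × ℕ) n =>
      (Φ.toFun x.1 (Nat.pair x.2 n)).map fun m => decide (m = 0)) ?_
    refine Partrec.map (f := fun x : (List Bool × ℕ) × ℕ => Φ.toFun x.1.1 (Nat.pair x.1.2 x.2)) ?_
      (PrimrecPred.decide (Primrec.eq.comp Primrec.snd (Primrec.const 0))).to_comp.to₂
    exact Φ.partrec.comp (Computable.fst.comp Computable.fst)
      (Primrec₂.natPair.to_comp.comp (Computable.snd.comp Computable.fst) Computable.snd)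
  mono := by
    intro σ τ n y h hy
    refine Nat.mem_rfind.2 ?_
    replace hy := Nat.mem_rfind.1 hy
    have key : ∀ {b m}, b ∈ (Φ.toFun σ (Nat.pair n m)).map (fun m => decide (m = 0)) →
        b ∈ (Φ.toFun τ (Nat.pair n m)).map (fun m => decide (m = 0)) := by
      intro b m hb
      rw [Part.mem_map_iff] at hb ⊢
      obtain ⟨c, hc, rfl⟩ := hb
      exact ⟨c, Φ.mono h hc, rfl⟩
    exact ⟨key hy.1, fun hm => key (hy.2 hm)⟩

theorem Computes.rfind {Φ : Functional} {g : ℕ → Bool} {f : ℕ →. ℕ} (hf : Φ.Computes g f) :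
    Φ.rfind.Computes g fun a => Nat.rfind fun n => (fun m => m = 0) <$> f (Nat.pair a n) := by
  intro n y
  refine Nat.mem_rfind.trans (Iff.trans ?_ (exists_congr fun k => Nat.mem_rfind.symm))
  have common : ∀ b m, b ∈ ((fun m => decide (m = 0)) <$> f (Nat.pair n m) : Part Bool) →
      ∃ k, ∀ l, k ≤ l → b ∈ (Φ.toFun (initSeg g l) (Nat.pair n m)).map
        (fun m => decide (m = 0)) := by
    intro b m hb
    simp only [Part.map_eq_map, Part.mem_map_iff] at hb ⊢
    obtain ⟨c, hc, rfl⟩ := hb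
    obtain ⟨k, hk⟩ := hf.common hc
    exact ⟨k, fun l hl => ⟨c, hk l hl, rfl⟩⟩
  constructor
  · rintro ⟨h0, h1⟩
    obtain ⟨k, hk⟩ := common _ _ h0
    -- The uses of the finitely many negative answers are bounded, too.
    have h2 : ∀ y', y' ≤ y → ∃ l, ∀ m < y', ∀ j, l ≤ j →
        false ∈ (Φ.toFun (initSeg g j) (Nat.pair n m)).map (fun m => decide (m = 0)) := by
      intro y'
      induction y' with
      | zero => exact fun _ => ⟨0, fun m hm => absurd hm (Nat.not_lt_zero _)⟩
      | succ y' ih =>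
        intro hy
        obtain ⟨l, hl⟩ := ih (Nat.le_of_succ_le hy)
        obtain ⟨l', hl'⟩ := common _ _ (h1 (m := y') hy)
        refine ⟨max l l', fun m hm j hj => ?_⟩
        rcases Nat.lt_succ_iff_lt_or_eq.1 hm with hm | rfl
        · exact hl m hm j (le_of_max_le_left hj)
        · exact hl' j (le_of_max_le_right hj)
    obtain ⟨l, hl⟩ := h2 y le_rfl
    exact ⟨max k l, hk _ (le_max_left _ _), fun hm => hl _ hm _ (le_max_right _ _)⟩
  · rintro ⟨k, h0, h1⟩
    have back : ∀ b m, b ∈ (Φ.toFun (initSeg g k) (Nat.pair n m)).map (fun m => decide (m = 0)) →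
        b ∈ ((fun m => decide (m = 0)) <$> f (Nat.pair n m) : Part Bool) := by
      intro b m hb
      simp only [Part.map_eq_map, Part.mem_map_iff] at hb ⊢
      obtain ⟨c, hc, rfl⟩ := hb
      exact ⟨c, (hf _ _).2 ⟨k, hc⟩, rfl⟩
    exact ⟨back _ _ h0, fun hm => back _ _ (h1 hm)⟩

/-- The use principle: a computation relative to `g` is carried out by a functional. -/
theorem exists_computes {g : ℕ → Bool} {f : ℕ →. ℕ}
    (hf : Nat.RecursiveIn {fun n => Part.some (g n).toNat} f) :
    ∃ Φ : Functional, Φ.Computes g f := by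
  induction hf with
  | zero => exact ⟨_, computes_ofPartrec _ .zero g⟩
  | succ => exact ⟨_, computes_ofPartrec _ .succ g⟩
  | left => exact ⟨_, computes_ofPartrec _ .left g⟩
  | right => exact ⟨_, computes_ofPartrec _ .right g⟩
  | oracle h hh =>
    obtain rfl := Set.mem_singleton_iff.1 hh
    exact ⟨_, computes_query g⟩
  | pair _ _ ihf ihg =>
    obtain ⟨Φ, hΦ⟩ := ihf
    obtain ⟨Ψ, hΨ⟩ := ihg
    exact ⟨_, hΦ.pair hΨ⟩
  | comp _ _ ihf ihg =>
    obtain ⟨Φ, hΦ⟩ := ihf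
    obtain ⟨Ψ, hΨ⟩ := ihg
    exact ⟨_, hΦ.comp hΨ⟩
  | prec _ _ ihf ihg =>
    obtain ⟨Φ, hΦ⟩ := ihf
    obtain ⟨Ψ, hΨ⟩ := ihg
    exact ⟨_, hΦ.prec hΨ⟩
  | rfind _ ihf =>
    obtain ⟨Φ, hΦ⟩ := ihf
    exact ⟨_, hΦ.rfind⟩

instance : Countable Functional := by
  -- The code of the partial recursive function of a functional determines it.
  have h : ∀ Φ : Functional, ∃ c : Nat.Partrec.Code, c.eval = fun n =>
      Part.bind (Encodable.decode (α := List Bool × ℕ) n) fun a : List Bool × ℕ =>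
        (Φ.toFun a.1 a.2).map Encodable.encode :=
    fun Φ => Nat.Partrec.Code.exists_code.1 Φ.partrec
  choose c hc using h
  refine Function.Injective.countable (f := c) fun Φ Ψ hΦΨ => ?_
  have key : Φ.toFun = Ψ.toFun := by
    funext σ n
    have := congrFun ((hc Φ).symm.trans ((congrArg _ hΦΨ).trans (hc Ψ))) (Encodable.encode (σ, n))
    simp only [Encodable.encodek, Part.coe_some, Part.bind_some] at this
    ext y
    have := congrArg (fun p : Part ℕ => y ∈ p) this
    simpa using this
  cases Φ; cases Ψ; cases key; rfl

end Functional

/-! ### Computability relative to an oracle -/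

section Relative

variable {α β γ : Type} [Primcodable α] [Primcodable β] [Primcodable γ] {O : Set (ℕ →. ℕ)}

theorem RecursiveIn.comp_computableIn {f : β →. γ} {g : α → β} (hf : RecursiveIn O f)
    (hg : ComputableIn O g) : RecursiveIn O fun a => f (g a) :=
  (Nat.RecursiveIn.comp hf hg).of_eq fun n => by
    rcases e : (Encodable.decode n : Option α) with - | a <;> simp [Encodable.encodek]

theorem ComputableIn.comp {f : β → γ} {g : α → β} (hf : ComputableIn O f)
    (hg : ComputableIn O g) : ComputableIn O fun a => f (g a) :=
  RecursiveIn.comp_computableIn (f := fun b => Part.some (f b)) hf hg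

theorem ComputableIn.pair {f : α → β} {g : α → γ} (hf : ComputableIn O f)
    (hg : ComputableIn O g) : ComputableIn O fun a => (f a, g a) :=
  (Nat.RecursiveIn.pair hf hg).of_eq fun n => by
    rcases e : (Encodable.decode n : Option α) with - | a <;> simp [Seq.seq]

/-- Sequences defined by recursion with an oracle-computable step are oracle-computable. -/
theorem ComputableIn.nat_rec {f : ℕ × α → α} (hf : ComputableIn O f) (a : α) :
    ComputableIn O fun n : ℕ => (Nat.rec a (fun s x => f (s, x)) n : α) := by
  have hc : Nat.RecursiveIn O fun _ => Part.some (Encodable.encode a) :=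
    Nat.Partrec.recursiveIn (Nat.Partrec.of_primrec (Nat.Primrec.const _))
  have hr : Nat.RecursiveIn O fun n => Part.some n.unpair.2 := Nat.RecursiveIn.right
  have hz : Nat.RecursiveIn O fun n => Part.some (Nat.pair 0 n) :=
    Nat.Partrec.recursiveIn (Nat.Partrec.of_primrec
      ((Nat.Primrec.const 0).pair Nat.Primrec.id))
  refine ((Nat.RecursiveIn.prec hc (Nat.RecursiveIn.comp hf hr)).comp hz).of_eq fun n => ?_
  simp only [Part.bind_eq_bind, Part.bind_some, Nat.unpair_pair, Encodable.decode_nat,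
    Part.coe_some, Part.map_some]
  induction n with
  | zero => rfl
  | succ n ih =>
    simp only
    rw [ih]
    simp
end Relative

/-! ### A generic colouring computable from the halting set -/

namespace SigmaOne

variable {α β : Type} [Primcodable α] [Primcodable β]

/-- The halting set is many-one complete among the Σ₁ predicates. -/
theorem exists_reduction {p : α → Prop} (hp : SigmaOne p) :
    ∃ g : α → ℕ, Primrec g ∧ ∀ a, p a ↔ g a ∈ haltingSet := by
  obtain ⟨c, hc⟩ := hp.exists_code
  refine ⟨fun a => Encodable.encode ((c.comp .left).curry (Encodable.encode a)), ?_, fun a => ?_⟩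
  · exact Primrec.encode.comp (Nat.Partrec.Code.primrec₂_curry.comp (Primrec.const _)
      Primrec.encode)
  · rw [hc, haltingSet, Set.mem_ofPred_eq, Denumerable.ofNat_encode, Nat.Partrec.Code.eval_curry]
    change _ ↔ ((Part.some (Nat.unpair _).1).bind c.eval).Dom
    refine iff_of_eq (congrArg Part.Dom ((Part.bind_some _ c.eval).trans ?_).symm)
    rw [Nat.unpair_pair]

/-- Uniformization: witnesses of a Σ₁ predicate can be found by a partial recursive search. -/
theorem exists_search {p : α × β → Prop} (hp : SigmaOne p) :
    ∃ f : α →. β, Partrec f ∧ (∀ a, ∀ b ∈ f a, p (a, b)) ∧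
      ∀ a, (∃ b, p (a, b)) → (f a).Dom := by
  classical
  obtain ⟨R, hR, h⟩ := hp
  let s : α → ℕ → Option β := fun a k =>
    (Encodable.decode (α := β) k.unpair.1).bind fun b =>
      if R (a, b) k.unpair.2 then some b else none
  have hs : Primrec₂ s := by
    refine Primrec.option_bind
      (Primrec.decode.comp (Primrec.fst.comp (Primrec.unpair.comp Primrec.snd))) ?_
    exact Primrec.ite (hR.comp ((Primrec.fst.comp Primrec.fst).pair Primrec.snd)
      (Primrec.snd.comp (Primrec.unpair.comp (Primrec.snd.comp Primrec.fst))))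
      (Primrec.option_some.comp Primrec.snd) (Primrec.const none)
  refine ⟨fun a => Nat.rfindOpt (s a), Partrec.rfindOpt hs.to_comp, ?_, ?_⟩
  · intro a b hb
    obtain ⟨k, hk⟩ := Nat.rfindOpt_spec hb
    simp only [s, Option.mem_def, Option.bind_eq_some_iff, Option.ite_none_right_eq_some,
      Option.some.injEq] at hk
    obtain ⟨b', -, hb', rfl⟩ := hk
    exact (h _).2 ⟨_, hb'⟩
  · rintro a ⟨b, hb⟩
    obtain ⟨k, hk⟩ := (h _).1 hb
    refine Nat.rfindOpt_dom.2 ⟨Nat.pair (Encodable.encode b) k, b, ?_⟩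
    simp [s, hk]

/-- With the halting set as an oracle, a witness of a Σ₁ predicate can be found whenever there is
one, and its absence can be recognized. -/
theorem exists_computableIn_search {p : α × β → Prop} (hp : SigmaOne p) :
    ∃ f : α → Option β, ComputableIn {charOracle haltingSet} f ∧
      (∀ a, ∀ b ∈ f a, p (a, b)) ∧ ∀ a, f a = none → ∀ b, ¬ p (a, b) := by
  classical
  obtain ⟨g, hg, hpg⟩ := hp.exists_snd.exists_reduction
  obtain ⟨s, hs, hs₁, hs₂⟩ := hp.exists_search
  -- The search is started only after the oracle has guaranteed that it succeeds.
  have hF : Partrec fun x : ℕ × α =>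
      (Nat.casesOn x.1 (Part.some none) fun _ => (s x.2).map some : Part (Option β)) :=
    Partrec.nat_casesOn_right (h := fun (x : ℕ × α) (_ : ℕ) => (s x.2).map some)
      Computable.fst (Computable.const none)
      (Partrec.map (f := fun y : (ℕ × α) × ℕ => s y.1.2) (g := fun _ b => some b)
        (hs.comp (Computable.snd.comp Computable.fst)) (Computable.option_some.comp Computable.snd))
  have hO : ComputableIn {charOracle haltingSet}
      (haltingSet.indicator fun _ => 1 : ℕ → ℕ) := RecursiveIn.oracle _ rfl
  have hχ : ComputableIn {charOracle haltingSet} fun a =>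
      (haltingSet.indicator (fun _ => 1) (g a) : ℕ) :=
    ComputableIn.comp hO hg.computableIn
  have hrec := RecursiveIn.comp_computableIn hF.recursiveIn (hχ.pair ComputableIn.id)
  let f : α → Option β := fun a => if h : ∃ b, p (a, b) then some ((s a).get (hs₂ a h)) else none
  refine ⟨f, hrec.of_eq fun a => ?_, ?_, ?_⟩
  · by_cases h : ∃ b, p (a, b)
    · have := (hpg a).1 h
      simp only [f, dif_pos h, Set.indicator_of_mem this, id]
      exact Part.eq_some_iff.2 (Part.mem_map some (Part.get_mem _))
    · have := mt (hpg a).2 h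
      simp [f, dif_neg h, Set.indicator_of_notMem this]
  · intro a b hb
    by_cases h : ∃ b, p (a, b)
    · simp only [f, dif_pos h, Option.mem_def, Option.some.injEq] at hb
      exact hs₁ a b (hb ▸ Part.get_mem _)
    · simp [f, dif_neg h] at hb
  · intro a ha b hb
    have h : ∃ b, p (a, b) := ⟨b, hb⟩
    simp [f, dif_pos h] at ha

end SigmaOne

/-- A colouring is generic if each Σ₁ set of strings contains an initial segment of it or is
disjoint from the set of extensions of some initial segment. -/
def RT1Instance.Generic {k : ℕ} (I : RT1Instance k) : Prop :=
  ∀ W : List (Fin k) → Prop, SigmaOne W →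
    ∃ n, W (initSeg I n) ∨ ∀ σ, initSeg I n <+: σ → ¬ W σ

theorem exists_generic_zeroJumpComputable (k : ℕ) [NeZero k] :
    ∃ I : RT1Instance k, I.ZeroJumpComputable ∧ I.Generic := by
  -- `U ((e, σ), τ)`: the string `σ ++ τ` belongs to the `e`-th Σ₁ set.
  let U : (ℕ × List (Fin k)) × List (Fin k) → Prop := fun x => ∃ y,
    y ∈ (Denumerable.ofNat Nat.Partrec.Code x.1.1).eval (Encodable.encode (x.1.2 ++ x.2))
  have hU : SigmaOne U := by
    refine SigmaOne.exists_snd (SigmaOne.eval_graph.comp (f := fun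
      z : ((ℕ × List (Fin k)) × List (Fin k)) × ℕ => ((Denumerable.ofNat Nat.Partrec.Code z.1.1.1,
        Encodable.encode (z.1.1.2 ++ z.1.2)), z.2)) ?_)
    have h1 : Primrec fun z : ((ℕ × List (Fin k)) × List (Fin k)) × ℕ => z.1.1 :=
      Primrec.fst.comp Primrec.fst
    exact (((Primrec.ofNat _).comp (Primrec.fst.comp h1)).pair (Primrec.encode.comp
      (Primrec.list_append.comp (Primrec.snd.comp h1) (Primrec.snd.comp Primrec.fst)))).pair
        Primrec.snd
  obtain ⟨f, hf, hf₁, hf₂⟩ := hU.exists_computableIn_search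
  -- Each stage appends a colour, so that the strings have a limit.
  let step : ℕ × List (Fin k) → List (Fin k) := fun x => x.2 ++ (f x).getD [] ++ [0]
  have hstep : ComputableIn {charOracle haltingSet} step := by
    have h : Primrec fun y : (ℕ × List (Fin k)) × Option (List (Fin k)) =>
        y.1.2 ++ y.2.getD [] ++ [0] :=
      Primrec.list_concat.comp (Primrec.list_append.comp (Primrec.snd.comp Primrec.fst)
        (Primrec.option_getD.comp Primrec.snd (Primrec.const []))) (Primrec.const 0)
    exact ComputableIn.comp h.computableIn (ComputableIn.id.pair hf)
  let S : ℕ → List (Fin k) := fun n => Nat.rec [] (fun s x => step (s, x)) n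
  have hS : ComputableIn {charOracle haltingSet} S := hstep.nat_rec []
  have hSs : ∀ s, S (s + 1) = S s ++ (f (s, S s)).getD [] ++ [0] := fun s => rfl
  let I : RT1Instance k := fun n => (S (n + 1)).getD n 0
  have hlen : ∀ s, s ≤ (S s).length := by
    intro s
    induction s with
    | zero => simp
    | succ s ih => rw [hSs]; simp only [List.length_append, List.length_singleton]; omega
  have hmono : ∀ s t, s ≤ t → S s <+: S t := by
    intro s t h
    induction t, h using Nat.le_induction with
    | base => exact List.prefix_rfl
    | succ t _ ih =>
      rw [hSs, List.append_assoc]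
      exact ih.trans (List.prefix_append _ _)
  have hI : ∀ s σ, σ <+: S s → σ = initSeg I σ.length := by
    intro s σ hσ
    refine List.ext_getElem? fun m => ?_
    rw [getElem?_initSeg]
    split_ifs with hm
    · have hm' : m < (S (m + 1)).length := hlen (m + 1)
      have h1 : (S (max s (m + 1)))[m]? = some σ[m] :=
        (hσ.trans (hmono _ _ (le_max_left _ _))).getElem?_eq_some (List.getElem?_eq_getElem hm)
      have h2 : (S (max s (m + 1)))[m]? = some (S (m + 1))[m] :=
        (hmono _ _ (le_max_right _ _)).getElem?_eq_some (List.getElem?_eq_getElem hm')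
      rw [List.getElem?_eq_getElem hm, ← h1, h2]
      simp [I, hm']
    · exact List.getElem?_eq_none (not_lt.1 hm)
  refine ⟨I, ?_, ?_⟩
  · have h : Primrec fun y : ℕ × List (Fin k) => y.2.getD y.1 0 :=
      (Primrec.list_getD 0).comp Primrec.snd Primrec.fst
    have h' : ComputableIn {charOracle haltingSet} fun n => S (n + 1) :=
      ComputableIn.comp hS ComputableIn.succ
    exact ComputableIn.comp h.computableIn (ComputableIn.id.pair h')
  · intro W hW
    obtain ⟨c, hc⟩ := hW.exists_code
    set s := Encodable.encode c with hs
    have hWU : ∀ σ τ, W (σ ++ τ) ↔ U ((s, σ), τ) := fun σ τ => by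
      simp only [hc, U, hs, Denumerable.ofNat_encode, Part.dom_iff_mem]
    rcases hfs : f (s, S s) with _ | τ
    · refine ⟨(S s).length, Or.inr ?_⟩
      rw [← hI s _ List.prefix_rfl]
      rintro _ ⟨τ, rfl⟩ hτ
      exact hf₂ _ hfs τ ((hWU _ _).1 hτ)
    · refine ⟨(S s ++ τ).length, Or.inl ?_⟩
      rw [← hI (s + 1)]
      · exact (hWU _ _).2 (hf₁ _ _ hfs)
      · rw [hSs, hfs]
        exact List.prefix_append _ _

/-! ### Effective compactness -/

/-- All strings of length `k` with entries below `b`. -/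
def boundedStrings (b : ℕ) : ℕ → List (List ℕ)
  | 0 => [[]]
  | k + 1 => (boundedStrings b k).flatMap fun σ => (List.range b).map fun v => σ ++ [v]

theorem mem_boundedStrings {b k : ℕ} {σ : List ℕ} :
    σ ∈ boundedStrings b k ↔ ∃ x : ℕ → ℕ, (∀ n < k, x n < b) ∧ σ = initSeg x k := by
  induction k generalizing σ with
  | zero => simp [boundedStrings, initSeg]
  | succ k ih =>
    simp only [boundedStrings, List.mem_flatMap, List.mem_map, List.mem_range, ih]
    constructor
    · rintro ⟨_, ⟨x, hx, rfl⟩, v, hv, rfl⟩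
      refine ⟨fun n => if n = k then v else x n, fun n hn => ?_, ?_⟩
      · simp only
        split_ifs with h
        · exact hv
        · exact hx n (by omega)
      · rw [initSeg_succ, if_pos rfl]
        congr 1
        refine List.map_congr_left fun n hn => ?_
        rw [if_neg (List.mem_range.1 hn).ne]
    · rintro ⟨x, hx, rfl⟩
      exact ⟨_, ⟨x, fun n hn => hx n (by omega), rfl⟩, x k, hx k k.lt_succ_self,
        (initSeg_succ x k).symm⟩

theorem primrec_boundedStrings (b : ℕ) : Primrec (boundedStrings b) := by
  have h : Primrec₂ fun (_ : ℕ) (l : List (List ℕ)) =>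
      l.flatMap fun σ => (List.range b).map fun v => σ ++ [v] := by
    refine Primrec.list_flatMap Primrec.snd ?_
    exact Primrec.list_map (Primrec.const _)
      (Primrec.list_concat.comp (Primrec.snd.comp Primrec.fst) Primrec.snd).to₂
  refine (Primrec.nat_rec₁ [[]] h).of_eq fun k => ?_
  induction k with
  | zero => rfl
  | succ k ih => simp only [boundedStrings]; rw [← ih]

/-- Compactness of the space of sequences bounded by `b`: if every such sequence is caught by a
family of properties of initial segments, then finitely many members of the family and initial
segments of bounded length suffice. -/
theorem exists_uniform_bound {b : ℕ} {B : ℕ → List ℕ → Prop}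
    (h : ∀ x : ℕ → ℕ, (∀ n, x n < b) → ∃ t k, B t (initSeg x k)) :
    ∃ s, ∀ x : ℕ → ℕ, (∀ n, x n < b) → ∃ t ≤ s, ∃ k ≤ s, B t (initSeg x k) := by
  let U : ℕ → Set (ℕ → Fin b) := fun s =>
    {x | ∃ t ≤ s, ∃ k ≤ s, B t (initSeg (fun n => (x n : ℕ)) k)}
  have hU : ∀ s, IsOpen (U s) := by
    intro s
    have : U s = ⋃ t ∈ Set.Iic s, ⋃ k ∈ Set.Iic s,
        (fun x : ℕ → Fin b => fun i : Fin k => x i) ⁻¹'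
          {y | B t (List.ofFn fun i => (y i : ℕ))} := by
      ext x
      simp only [U, Set.mem_ofPred_eq, Set.mem_iUnion, Set.mem_Iic, Set.mem_preimage, exists_prop]
      have : ∀ k, initSeg (fun n => (x n : ℕ)) k = List.ofFn fun i : Fin k => (x i : ℕ) := by
        intro k
        refine List.ext_getElem (by simp) fun m _ _ => ?_
        simp [initSeg]
      simp [this]
    rw [this]
    refine isOpen_biUnion fun t _ => isOpen_biUnion fun k _ =>
      IsOpen.preimage ?_ (isOpen_discrete _)
    fun_prop
  have hmono : Monotone U := fun s s' hs x ⟨t, ht, k, hk, hB⟩ =>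
    ⟨t, ht.trans hs, k, hk.trans hs, hB⟩
  obtain ⟨s, hs⟩ := isCompact_univ.elim_directed_cover U hU (fun x _ => by
      obtain ⟨t, k, hB⟩ := h (fun n => x n) fun n => (x n).2
      exact Set.mem_iUnion.2 ⟨max t k, t, le_max_left _ _, k, le_max_right _ _, hB⟩)
    hmono.directed_le
  exact ⟨s, fun x hx => hs (Set.mem_univ fun n => (⟨x n, hx n⟩ : Fin b))⟩

namespace SigmaOne

variable {α : Type} [Primcodable α]

/-- Universal quantification over a compact space preserves Σ₁ predicates. -/
theorem forall_bounded {B : α × List ℕ → Prop} (hB : SigmaOne B) {b : ℕ}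
    (hb : 0 < b) :
    SigmaOne fun a => ∀ x : ℕ → ℕ, (∀ n, x n < b) → ∃ k, B (a, initSeg x k) := by
  -- It suffices to look at the initial segments of a single length `s`.
  have h : SigmaOne fun a => ∃ s, ∀ σ ∈ boundedStrings b s, ∃ k, B (a, σ.take k) := by
    have h1 : SigmaOne fun z : (α × ℕ) × List ℕ => ∃ k, B (z.1.1, z.2.take k) := by
      refine SigmaOne.exists_snd (hB.comp (f := fun y : ((α × ℕ) × List ℕ) × ℕ =>
        (y.1.1.1, y.1.2.take y.2)) ?_)
      exact (Primrec.fst.comp (Primrec.fst.comp Primrec.fst)).pair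
        (Primrec.list_take.comp Primrec.snd (Primrec.snd.comp Primrec.fst))
    exact SigmaOne.exists_snd (h1.forall_mem_list
      ((primrec_boundedStrings b).comp Primrec.snd))
  refine h.of_eq fun a => ⟨?_, fun hx => ?_⟩
  · rintro ⟨s, hs⟩ x hx
    obtain ⟨k, hk⟩ := hs _ (mem_boundedStrings.2 ⟨x, fun n _ => hx n, rfl⟩)
    rw [take_initSeg] at hk
    exact ⟨_, hk⟩
  · obtain ⟨s, hs⟩ := exists_uniform_bound (B := fun _ σ => B (a, σ))
      fun x hx' => ⟨0, hx x hx'⟩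
    refine ⟨s, fun σ hσ => ?_⟩
    obtain ⟨x, hx, rfl⟩ := mem_boundedStrings.1 hσ
    obtain ⟨t, -, k, hk, hB⟩ := hs (fun n => if n < s then x n else 0) fun n => by
      split_ifs with h
      exacts [hx n h, hb]
    refine ⟨k, ?_⟩
    rw [take_initSeg, min_eq_left hk]
    convert hB using 2
    refine List.map_congr_left fun n hn => ?_
    rw [if_pos ((List.mem_range.1 hn).trans_le hk)]

end SigmaOne

/-! ### Effectively closed classes of bounded sequences -/

/-- A class of sequences of natural numbers is a bounded `Π⁰₁` class if it consists of the sequences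
that are bounded by some fixed number and have no initial segment in some fixed Σ₁ set. -/
def IsBoundedPiClass (P : Set (ℕ → ℕ)) : Prop :=
  ∃ b, 0 < b ∧ ∃ K : List ℕ → Prop, SigmaOne K ∧
    ∀ x, x ∈ P ↔ (∀ n, x n < b) ∧ ∀ k, ¬ K (initSeg x k)

namespace IsBoundedPiClass

variable {P : Set (ℕ → ℕ)}

theorem singleton_zero : IsBoundedPiClass {fun _ => 0} := by
  refine ⟨1, one_pos, fun _ => False, .of_primrecPred ?_, fun x => ?_⟩
  · exact (Primrec.eq.comp (Primrec.const 0) (Primrec.const 1)).of_eq fun _ => by simp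
  · simp [funext_iff]

theorem sep (hP : IsBoundedPiClass P) {V : List ℕ → Prop} (hV : SigmaOne V) :
    IsBoundedPiClass {x ∈ P | ∀ k, ¬ V (initSeg x k)} := by
  obtain ⟨b, hb, K, hK, h⟩ := hP
  refine ⟨b, hb, _, hK.or hV, fun x => ?_⟩
  rw [Set.mem_sep_iff, h, and_assoc, ← forall_and]
  simp only [not_or]

/-- The bounded sequences that refine, by one more bit, a member of a class. -/
theorem half (hP : IsBoundedPiClass P) : IsBoundedPiClass {x | (fun n => x n / 2) ∈ P} := by
  obtain ⟨b, hb, K, hK, h⟩ := hP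
  refine ⟨2 * b, by omega, fun σ => K (σ.map (· / 2)), hK.comp ?_, fun x => ?_⟩
  · exact Primrec.list_map Primrec.id
      (Primrec.nat_div.comp Primrec.snd (Primrec.const 2)).to₂
  · rw [Set.mem_ofPred_eq, h]
    refine and_congr (forall_congr' fun n => by omega) (forall_congr' fun k => ?_)
    simp only [initSeg, List.map_map]
    rfl

theorem sep_forall_mem_eq (hP : IsBoundedPiClass P) (l : List ℕ) (w : ℕ) :
    IsBoundedPiClass {x ∈ P | ∀ m ∈ l, x m = w} := by
  have hV : SigmaOne fun σ : List ℕ => ∃ m ∈ l, σ[m]? ≠ none ∧ σ[m]? ≠ some w := by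
    refine .of_primrecPred ?_
    have h : PrimrecRel fun (m : ℕ) (σ : List ℕ) => σ[m]? ≠ none ∧ σ[m]? ≠ some w := by
      have h1 : Primrec fun x : ℕ × List ℕ => x.2[x.1]? :=
        Primrec.list_getElem?.comp Primrec.snd Primrec.fst
      exact (Primrec.eq.comp h1 (Primrec.const none)).not.and
        (Primrec.eq.comp h1 (Primrec.const (some w))).not
    exact (PrimrecRel.exists_mem_list h).comp (Primrec.const l) Primrec.id
  convert hP.sep hV using 1
  ext x
  refine and_congr_right fun _ => ⟨?_, fun h m hm => ?_⟩
  · rintro h k ⟨m, hm, h1, h2⟩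
    rw [getElem?_initSeg] at h1 h2
    split_ifs at h1 h2
    · exact h2 (by rw [h m hm])
    · exact h1 rfl
  · by_contra hne
    refine h (m + 1) ⟨m, hm, ?_⟩
    rw [(getElem?_initSeg_eq_some x).2 ⟨m.lt_succ_self, rfl⟩]
    simpa using hne

theorem sep_forall_ge_ne (hP : IsBoundedPiClass P) (k w : ℕ) :
    IsBoundedPiClass {x ∈ P | ∀ m, k ≤ m → x m ≠ w} := by
  have hV : SigmaOne fun σ : List ℕ => ∃ m, k ≤ m ∧ σ[m]? = some w := by
    refine SigmaOne.exists_snd (p := fun z : List ℕ × ℕ => k ≤ z.2 ∧ z.1[z.2]? = some w)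
      (.of_primrecPred ?_)
    exact (Primrec.nat_le.comp (Primrec.const k) Primrec.snd).and
      (Primrec.eq.comp (Primrec.list_getElem?.comp Primrec.fst Primrec.snd)
        (Primrec.const (some w)))
  convert hP.sep hV using 1
  ext x
  refine and_congr_right fun _ => ⟨?_, fun h m hm hw => ?_⟩
  · rintro h l ⟨m, hm, h1⟩
    exact h m hm (getElem?_initSeg_eq_some x |>.1 h1).2
  · exact h (m + 1) ⟨m, hm, (getElem?_initSeg_eq_some x).2 ⟨m.lt_succ_self, hw⟩⟩

end IsBoundedPiClass

/-- The use of genericity. Let `T` enumerate, uniformly in a sequence `x`, a set of numbers. Either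
this set contains a number of colour `i` for all `x` in the given class, or it is finite for some
`x` in the class. -/
theorem RT1Instance.Generic.dichotomy {c : ℕ} {I : RT1Instance c} (hI : I.Generic)
    {P : Set (ℕ → ℕ)} (hP : IsBoundedPiClass P) {T : List ℕ × ℕ → Prop} (hT : SigmaOne T)
    (i : Fin c) :
    (∀ x ∈ P, ∃ n k, T (initSeg x k, n) ∧ I n = i) ∨
      ∃ N, ∃ x ∈ P, ∀ n k, T (initSeg x k, n) → n < N := by
  obtain ⟨b, hb, K, hK, h⟩ := hP
  -- By compactness, it is a Σ₁ event that a string forces the first alternative.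
  have hW : SigmaOne fun σ : List (Fin c) => ∀ x : ℕ → ℕ, (∀ n, x n < b) →
      ∃ k, (K (initSeg x k) ∨ ∃ n, T (initSeg x k, n) ∧ σ[n]? = some i) := by
    refine SigmaOne.forall_bounded (B := fun y : List (Fin c) × List ℕ =>
      K y.2 ∨ ∃ n, T (y.2, n) ∧ y.1[n]? = some i) ((hK.comp Primrec.snd).or ?_) hb
    refine SigmaOne.exists_snd (p := fun z : (List (Fin c) × List ℕ) × ℕ =>
      T (z.1.2, z.2) ∧ z.1.1[z.2]? = some i) (SigmaOne.and ?_ (.of_primrecPred ?_))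
    · exact hT.comp (f := fun z : (List (Fin c) × List ℕ) × ℕ => (z.1.2, z.2))
        ((Primrec.snd.comp Primrec.fst).pair Primrec.snd)
    · exact Primrec.eq.comp (Primrec.list_getElem?.comp (Primrec.fst.comp Primrec.fst) Primrec.snd)
        (Primrec.const (some i))
  obtain ⟨N, hN | hN⟩ := hI _ hW
  · refine Or.inl fun x hx => ?_
    obtain ⟨hxb, hxK⟩ := (h x).1 hx
    obtain ⟨k, hk | ⟨n, hn, hi⟩⟩ := hN x hxb
    · exact absurd hk (hxK k)
    · exact ⟨n, k, hn, ((getElem?_initSeg_eq_some I).1 hi).2⟩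
  · refine Or.inr ⟨N, ?_⟩
    by_contra! hcon
    obtain ⟨s, hs⟩ := exists_uniform_bound (b := b)
      (B := fun t σ => K σ ∨ (T (σ, t) ∧ N ≤ t)) fun x hxb => by
        by_cases hxK : ∃ k, K (initSeg x k)
        · obtain ⟨k, hk⟩ := hxK
          exact ⟨0, k, Or.inl hk⟩
        · obtain ⟨n, k, hn, hnN⟩ := hcon x ((h x).2 ⟨hxb, not_exists.1 hxK⟩)
          exact ⟨n, k, Or.inr ⟨hn, hnN⟩⟩
    -- Giving colour `i` to all numbers from `N` to `s` forces the first alternative after all.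
    refine hN (initSeg I N ++ List.replicate (s + 1) i) (List.prefix_append _ _) fun x hxb => ?_
    obtain ⟨t, ht, k, -, hk | ⟨hk, hNt⟩⟩ := hs x hxb
    · exact ⟨k, Or.inl hk⟩
    · refine ⟨k, Or.inr ⟨t, hk, ?_⟩⟩
      rw [List.getElem?_append_right (by simpa using hNt), List.getElem?_replicate, if_pos]
      simp only [length_initSeg]
      omega

/-! ### Stems and reservoirs -/

/-- `Compat ρ X τ`: the string `τ`, as a finite piece of a characteristic function, extends the stem
`ρ` by elements of the reservoir `X` only. -/
def Compat (ρ : List Bool) (X : Set ℕ) (τ : List Bool) : Prop :=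
  ρ <+: τ ∧ ∀ m, ρ.length ≤ m → τ[m]? = some true → m ∈ X

namespace Compat

variable {ρ σ τ : List Bool} {X Y : Set ℕ}

theorem refl (ρ : List Bool) (X : Set ℕ) : Compat ρ X ρ :=
  ⟨List.prefix_rfl, fun m hm h => by simp [List.getElem?_eq_none hm] at h⟩

theorem trans (h₁ : Compat ρ X σ) (h₂ : Compat σ Y τ) (h : Y ⊆ X) : Compat ρ X τ := by
  refine ⟨h₁.1.trans h₂.1, fun m hm hτ => ?_⟩
  rcases lt_or_ge m σ.length with hlt | hge
  · refine h₁.2 m hm ?_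
    have := h₂.1.getElem?_eq_some (List.getElem?_eq_getElem hlt)
    rw [List.getElem?_eq_getElem hlt, ← this, hτ]
  · exact h (h₂.2 m hge hτ)

end Compat

/-- The elements that the functional `Φ`, seen as a characteristic function, may yet enumerate from
the stem `ρ` and the reservoir `{m | x m = v}`, uniformly enumerated from initial segments of
`x`. -/
def Functional.Reach (Φ : Functional) (ρ : List Bool) (v : ℕ) (y : List ℕ × ℕ) : Prop :=
  ∃ τ : List Bool, (τ.take ρ.length = ρ ∧ ∀ m ∈ List.range τ.length,
    ρ.length ≤ m → τ[m]? = some true → y.1[m]? = some v) ∧ 1 ∈ Φ.toFun τ y.2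

theorem Functional.sigmaOne_reach (Φ : Functional) (ρ : List Bool) (v : ℕ) :
    SigmaOne (Φ.Reach ρ v) := by
  refine SigmaOne.exists_snd (p := fun z : (List ℕ × ℕ) × List Bool =>
    (z.2.take ρ.length = ρ ∧ ∀ m ∈ List.range z.2.length,
      ρ.length ≤ m → z.2[m]? = some true → z.1.1[m]? = some v) ∧ 1 ∈ Φ.toFun z.2 z.1.2)
    (SigmaOne.and (.of_primrecPred (.and ?_ ?_)) ?_)
  · exact Primrec.eq.comp (Primrec.list_take.comp (Primrec.const _) Primrec.snd)
      (Primrec.const ρ)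
  · have h : PrimrecRel fun (m : ℕ) (z : (List ℕ × ℕ) × List Bool) =>
        ¬ ρ.length ≤ m ∨ ¬ z.2[m]? = some true ∨ z.1.1[m]? = some v := by
      refine (Primrec.nat_le.comp (Primrec.const _) Primrec.fst).not.or (PrimrecPred.or ?_ ?_)
      · exact (Primrec.eq.comp (Primrec.list_getElem?.comp (Primrec.snd.comp Primrec.snd)
          Primrec.fst) (Primrec.const (some true))).not
      · exact Primrec.eq.comp (Primrec.list_getElem?.comp (Primrec.fst.comp (Primrec.fst.comp
          Primrec.snd)) Primrec.fst) (Primrec.const (some v))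
    refine ((PrimrecRel.forall_mem_list h).comp
      (Primrec.list_range.comp (Primrec.list_length.comp Primrec.snd)) Primrec.id).of_eq fun z => ?_
    simp only [imp_iff_not_or, id]
  · exact (SigmaOne.graph_of_partrec Φ.partrec).comp
      (f := fun z : (List ℕ × ℕ) × List Bool => ((z.2, z.1.2), 1))
      ((Primrec.snd.pair (Primrec.snd.comp Primrec.fst)).pair (Primrec.const 1))

/-- The stages of the enumeration `Reach` amount to the extensions of the stem within the
reservoir. -/
theorem Functional.exists_reach_initSeg (Φ : Functional) (ρ : List Bool) (v : ℕ) (x : ℕ → ℕ)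
    (n : ℕ) : (∃ k, Φ.Reach ρ v (initSeg x k, n)) ↔
      ∃ τ, Compat ρ {m | x m = v} τ ∧ 1 ∈ Φ.toFun τ n := by
  constructor
  · rintro ⟨k, τ, ⟨hρ, h⟩, h1⟩
    refine ⟨τ, ⟨List.prefix_iff_eq_take.2 hρ.symm, fun m hm hτ => ?_⟩, h1⟩
    exact ((getElem?_initSeg_eq_some x).1 (h m (List.mem_range.2
      (List.getElem?_eq_some_iff.1 hτ).1) hm hτ)).2
  · rintro ⟨τ, ⟨hρ, h⟩, h1⟩
    refine ⟨τ.length, τ, ⟨(List.prefix_iff_eq_take.1 hρ).symm, fun m hm hρm hτ => ?_⟩, h1⟩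
    exact (getElem?_initSeg_eq_some x).2 ⟨List.mem_range.1 hm, h m hρm hτ⟩

/-! ### The forcing notion -/

/-- A condition consists of two stems, which are to be extended to subsets of `L 0` and `L 1`, and
of a bounded `Π⁰₁` class. A member `x` of the class represents the reservoir `{n | x n = sym}`; all
reservoirs are infinite, and from `start` on they are covered by `L 0` and `L 1`. -/
structure Condition (L : Fin 2 → Set ℕ) where
  /-- The initial segments, already decided, of the two sets under construction. -/
  stem : Fin 2 → List Bool
  /-- The class of the sequences that represent the reservoirs. -/
  cls : Set (ℕ → ℕ)
  /-- The symbol that marks the elements of a reservoir. -/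
  sym : ℕ
  /-- A number, at most the lengths of the stems, from which on the reservoirs are covered. -/
  start : ℕ
  isBoundedPiClass : IsBoundedPiClass cls
  nonempty : cls.Nonempty
  infinite : ∀ x ∈ cls, {n | x n = sym}.Infinite
  covered : ∀ x ∈ cls, ∀ n, start ≤ n → x n = sym → ∃ j, n ∈ L j
  stem_mem : ∀ j m, (stem j)[m]? = some true → m ∈ L j
  start_le : ∀ j, start ≤ (stem j).length

namespace Condition

variable {L : Fin 2 → Set ℕ}

/-- The reservoir represented by a sequence. -/
def res (p : Condition L) (x : ℕ → ℕ) : Set ℕ := {n | x n = p.sym}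

/-- A condition `q` is above `p` if each reservoir of `q` is contained in a reservoir of `p` from
which the stems of `q` take their new elements. -/
instance : Preorder (Condition L) where
  le p q := ∀ y ∈ q.cls, ∃ x ∈ p.cls, q.res y ⊆ p.res x ∧
    ∀ j, Compat (p.stem j) (p.res x) (q.stem j)
  le_refl p := fun x hx => ⟨x, hx, subset_rfl, fun _ => Compat.refl _ _⟩
  le_trans p q r hpq hqr := by
    intro z hz
    obtain ⟨y, hy, hzy, hqr⟩ := hqr z hz
    obtain ⟨x, hx, hyx, hpq⟩ := hpq y hy
    exact ⟨x, hx, hzy.trans hyx, fun j => (hpq j).trans (hqr j) hyx⟩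

theorem stem_prefix {p q : Condition L} (h : p ≤ q) (j : Fin 2) : p.stem j <+: q.stem j := by
  obtain ⟨y, hy⟩ := q.nonempty
  obtain ⟨x, -, -, hx⟩ := h y hy
  exact (hx j).1

/-- A stem may be extended inside a reservoir and `L j`; the class is cut down to the sequences
whose reservoirs contain the new elements. -/
theorem exists_extend_stem (p : Condition L) (j : Fin 2) {x : ℕ → ℕ} (hx : x ∈ p.cls)
    {τ : List Bool} (hτ : Compat (p.stem j) (p.res x ∩ L j) τ) :
    ∃ q, p ≤ q ∧ q.stem j = τ := by
  classical
  let l : List ℕ := (List.range τ.length).filter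
    fun m => (p.stem j).length ≤ m ∧ τ[m]? = some true
  have hl : ∀ m, m ∈ l ↔ (p.stem j).length ≤ m ∧ τ[m]? = some true := by
    intro m
    simp only [l, List.mem_filter, List.mem_range, decide_eq_true_eq, and_iff_right_iff_imp]
    exact fun h => (List.getElem?_eq_some_iff.1 h.2).1
  let q : Condition L :=
    { stem := Function.update p.stem j τ
      cls := {y ∈ p.cls | ∀ m ∈ l, y m = p.sym}
      sym := p.sym
      start := p.start
      isBoundedPiClass := p.isBoundedPiClass.sep_forall_mem_eq l p.sym
      nonempty := ⟨x, hx, fun m hm => (hτ.2 m ((hl m).1 hm).1 ((hl m).1 hm).2).1⟩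
      infinite := fun y hy => p.infinite y hy.1
      covered := fun y hy => p.covered y hy.1
      stem_mem := by
        intro i m h
        rcases eq_or_ne i j with rfl | hij
        · rw [Function.update_self] at h
          rcases lt_or_ge m (p.stem i).length with hlt | hge
          · refine p.stem_mem i m ?_
            rw [List.getElem?_eq_getElem hlt,
              ← hτ.1.getElem?_eq_some (List.getElem?_eq_getElem hlt), h]
          · exact (hτ.2 m hge h).2
        · rw [Function.update_of_ne hij] at h
          exact p.stem_mem i m h
      start_le := by
        intro i
        rcases eq_or_ne i j with rfl | hij
        · rw [Function.update_self]
          exact (p.start_le i).trans hτ.1.length_le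
        · rw [Function.update_of_ne hij]
          exact p.start_le i }
  refine ⟨q, fun y hy => ⟨y, hy.1, subset_rfl, fun i => ?_⟩, Function.update_self ..⟩
  rcases eq_or_ne i j with rfl | hij
  · simp only [q, Function.update_self]
    exact ⟨hτ.1, fun m hm h => hy.2 m ((hl m).2 ⟨hm, h⟩)⟩
  · simp only [q, Function.update_of_ne hij]
    exact Compat.refl _ _

/-- The class may be replaced by one whose reservoirs are contained in those of the condition. -/
theorem exists_shrink (p : Condition L) {Q : Set (ℕ → ℕ)} (hQ : IsBoundedPiClass Q)
    (hne : Q.Nonempty) (v : ℕ) (hinf : ∀ x ∈ Q, {n | x n = v}.Infinite)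
    (h : ∀ y ∈ Q, ∃ x ∈ p.cls, {n | y n = v} ⊆ p.res x) :
    ∃ q, p ≤ q ∧ q.stem = p.stem ∧ q.cls = Q ∧ q.sym = v := by
  refine ⟨{
    stem := p.stem, cls := Q, sym := v, start := p.start, isBoundedPiClass := hQ, nonempty := hne,
    infinite := hinf, covered := fun y hy n hn hyn => ?_, stem_mem := p.stem_mem,
    start_le := p.start_le }, fun y hy => ?_, rfl, rfl, rfl⟩
  · obtain ⟨x, hx, hyx⟩ := h y hy
    exact p.covered x hx n hn (hyx hyn)
  · obtain ⟨x, hx, hyx⟩ := h y hy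
    exact ⟨x, hx, hyx, fun j => Compat.refl _ _⟩

/-- The condition settles that `Φ`, with the set built from the stem `j` as oracle, enumerates
an element of colour `i`, or that it enumerates only finitely many elements. -/
def Settles {c : ℕ} (I : RT1Instance c) (i : Fin c) (Φ : Functional) (q : Condition L) (j : Fin 2) :
    Prop :=
  (∃ n, I n = i ∧ 1 ∈ Φ.toFun (q.stem j) n) ∨
    ∃ N, ∀ x ∈ q.cls, ∀ n τ, Compat (q.stem j) (q.res x) τ → 1 ∈ Φ.toFun τ n → n < N

/-- Density: for two given functionals, every condition can be extended so as to settle one of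
them. -/
theorem exists_settles {c : ℕ} {I : RT1Instance c} (hI : I.Generic) (i : Fin c)
    (Φ : Fin 2 → Functional) (p : Condition L) : ∃ q, p ≤ q ∧ ∃ j, q.Settles I i (Φ j) j := by
  classical
  -- A member `x` of `P` splits the reservoir given by `x / 2` into a part for each of the stems.
  let P : Set (ℕ → ℕ) := {x | (fun n => x n / 2) ∈ p.cls}
  have hP : IsBoundedPiClass P := p.isBoundedPiClass.half
  let v : Fin 2 → ℕ := fun j => 2 * p.sym + j
  have hv : ∀ (x : ℕ → ℕ) j, {n | x n = v j} ⊆ p.res fun n => x n / 2 := by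
    intro x j n hn
    simp only [v, Set.mem_ofPred_eq, res] at hn ⊢
    have := j.2
    omega
  have hT : SigmaOne fun y => (Φ 0).Reach (p.stem 0) (v 0) y ∨ (Φ 1).Reach (p.stem 1) (v 1) y :=
    ((Φ 0).sigmaOne_reach _ _).or ((Φ 1).sigmaOne_reach _ _)
  rcases hI.dichotomy hP hT i with h | ⟨N, x₀, hx₀, h₀⟩
  · -- Split a reservoir according to `L`.
    obtain ⟨x, hx⟩ := p.nonempty
    have hch : ∀ n, ∃ j, p.start ≤ n → x n = p.sym → n ∈ L j := by
      intro n
      by_cases hn : p.start ≤ n ∧ x n = p.sym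
      · obtain ⟨j, hj⟩ := p.covered x hx n hn.1 hn.2
        exact ⟨j, fun _ _ => hj⟩
      · exact ⟨0, fun h1 h2 => absurd ⟨h1, h2⟩ hn⟩
    choose d hd using hch
    let x' : ℕ → ℕ := fun n => 2 * x n + d n
    have hx' : (fun n => x' n / 2) = x := by
      funext n
      have := (d n).2
      simp only [x']
      omega
    obtain ⟨n, k, hn, hi⟩ := h x' (by simpa only [P, Set.mem_ofPred_eq, hx'] using hx)
    have : ∃ j, ∃ τ, Compat (p.stem j) {m | x' m = v j} τ ∧ 1 ∈ (Φ j).toFun τ n := by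
      rcases hn with hn | hn
      · exact ⟨0, ((Φ 0).exists_reach_initSeg _ _ _ _).1 ⟨k, hn⟩⟩
      · exact ⟨1, ((Φ 1).exists_reach_initSeg _ _ _ _).1 ⟨k, hn⟩⟩
    obtain ⟨j, τ, hτ, h1⟩ := this
    obtain ⟨q, hpq, hq⟩ := p.exists_extend_stem j hx (τ := τ) ⟨hτ.1, fun m hm h => by
      have hm' : x' m = v j := hτ.2 m hm h
      have h2 : x m = p.sym ∧ d m = j := by
        have := (d m).2
        have := j.2
        simp only [x', v] at hm'
        rw [Fin.ext_iff]
        omega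
      exact ⟨h2.1, h2.2 ▸ hd m ((p.start_le j).trans hm) h2.1⟩⟩
    exact ⟨q, hpq, j, Or.inl ⟨n, hi, hq ▸ h1⟩⟩
  · -- Restrict to the splittings that yield no number from `N` on, and keep an infinite part.
    have hV : SigmaOne fun σ => ∃ n, N ≤ n ∧
        ((Φ 0).Reach (p.stem 0) (v 0) (σ, n) ∨ (Φ 1).Reach (p.stem 1) (v 1) (σ, n)) :=
      SigmaOne.exists_snd (p := fun y : List ℕ × ℕ => N ≤ y.2 ∧
        ((Φ 0).Reach (p.stem 0) (v 0) y ∨ (Φ 1).Reach (p.stem 1) (v 1) y))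
        (SigmaOne.and (.of_primrecPred (Primrec.nat_le.comp (Primrec.const N) Primrec.snd)) hT)
    let Q : Set (ℕ → ℕ) := {x ∈ P | ∀ k, ¬ ∃ n, N ≤ n ∧
      ((Φ 0).Reach (p.stem 0) (v 0) (initSeg x k, n) ∨
        (Φ 1).Reach (p.stem 1) (v 1) (initSeg x k, n))}
    have hQ : IsBoundedPiClass Q := hP.sep hV
    have hQ₀ : x₀ ∈ Q := ⟨hx₀, fun k ⟨n, hn, h⟩ => absurd (h₀ n k h) (not_lt.2 hn)⟩
    have hsettle : ∀ q : Condition L, q.stem = p.stem → q.cls ⊆ Q → ∀ j, q.sym = v j →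
        q.Settles I i (Φ j) j := by
      intro q hq₁ hq₂ j hq₃
      refine Or.inr ⟨N, fun x hx n τ hτ h1 => ?_⟩
      obtain ⟨k, hk⟩ := ((Φ j).exists_reach_initSeg (p.stem j) (v j) x n).2
        ⟨τ, by simpa only [hq₁, res, hq₃] using hτ, h1⟩
      by_contra! hn
      refine (hq₂ hx).2 k ⟨n, hn, ?_⟩
      fin_cases j
      · exact Or.inl hk
      · exact Or.inr hk
    have hsub : ∀ Q' ⊆ Q, ∀ j, ∀ y ∈ Q', ∃ x ∈ p.cls, {n | y n = v j} ⊆ p.res x :=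
      fun Q' hQ' j y hy => ⟨_, (hQ' hy).1, hv y j⟩
    by_cases hfin : ∃ k, ∃ x ∈ Q, ∀ m, k ≤ m → x m ≠ v 0
    · obtain ⟨k, x, hx, hxk⟩ := hfin
      have hQ' : {x ∈ Q | ∀ m, k ≤ m → x m ≠ v 0} ⊆ Q := Set.sep_subset _ _
      have hinf : ∀ y ∈ {x ∈ Q | ∀ m, k ≤ m → x m ≠ v 0}, {n | y n = v 1}.Infinite := by
        refine fun y hy hf => p.infinite _ hy.1.1
          ((hf.union (Set.finite_lt_nat k)).subset fun n hn => ?_)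
        rcases lt_or_ge n k with hlt | hge
        · exact Or.inr hlt
        · refine Or.inl ?_
          have := hy.2 n hge
          simp only [v, Set.mem_ofPred_eq, Fin.val_zero, Fin.val_one] at hn this ⊢
          omega
      obtain ⟨q, hpq, hq₁, hq₂, hq₃⟩ := p.exists_shrink (hQ.sep_forall_ge_ne k (v 0))
        ⟨x, hx, hxk⟩ (v 1) hinf (hsub _ hQ' 1)
      exact ⟨q, hpq, 1, hsettle q hq₁ (hq₂ ▸ hQ') 1 hq₃⟩
    · push Not at hfin
      obtain ⟨q, hpq, hq₁, hq₂, hq₃⟩ := p.exists_shrink hQ ⟨x₀, hQ₀⟩ (v 0)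
        (fun y hy => Set.infinite_of_not_bddAbove fun ⟨k, hk⟩ => by
          obtain ⟨m, hm, hy'⟩ := hfin (k + 1) y hy
          have := hk hy'
          omega) (hsub _ subset_rfl 0)
      exact ⟨q, hpq, 0, hsettle q hq₁ hq₂.subset 0 hq₃⟩

/-- Every condition has a reservoir with arbitrarily large elements of `L j`. -/
def Extendable (L : Fin 2 → Set ℕ) : Prop :=
  ∀ (q : Condition L) (j : Fin 2) (N : ℕ), ∃ x ∈ q.cls, ∃ m, N ≤ m ∧ x m = q.sym ∧ m ∈ L j

theorem Extendable.exists_stem_mem (hL : Extendable L) (p : Condition L) (j : Fin 2) (N : ℕ) :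
    ∃ q, p ≤ q ∧ ∃ m, N ≤ m ∧ (q.stem j)[m]? = some true := by
  obtain ⟨x, hx, m, hm, hxm, hmL⟩ := hL p j (max N (p.stem j).length)
  have hlen : (p.stem j).length ≤ m := (le_max_right _ _).trans hm
  have hρ : (p.stem j ++ List.replicate (m - (p.stem j).length) false).length = m := by
    simp only [List.length_append, List.length_replicate]
    omega
  obtain ⟨q, hpq, hq⟩ := p.exists_extend_stem j hx
    (τ := p.stem j ++ List.replicate (m - (p.stem j).length) false ++ [true]) <| by
      refine ⟨(List.prefix_append _ _).trans (List.prefix_append _ _), fun k hk h => ?_⟩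
      rcases lt_trichotomy k m with hlt | rfl | hgt
      · rw [List.getElem?_append_left (hρ.symm ▸ hlt), List.getElem?_append_right hk,
          List.getElem?_replicate] at h
        split_ifs at h
        simp at h
      · exact ⟨hxm, hmL⟩
      · rw [List.getElem?_eq_none] at h
        · simp at h
        · rw [List.length_append, hρ]
          exact hgt
  refine ⟨q, hpq, m, (le_max_left _ _).trans hm, ?_⟩
  rw [hq, List.getElem?_append_right hρ.le, hρ]
  simp

end Condition

/-! ### The generic sets -/

namespace Condition

variable {L : Fin 2 → Set ℕ}

/-- The sets built from a sufficiently generic sequence of conditions: for any two functionals, one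
of them enumerates from its set a number of colour `i` or only finitely many numbers. -/
theorem exists_generic_sets {c : ℕ} {I : RT1Instance c} (hI : I.Generic) (p : Condition L)
    (hL : Extendable L) : ∃ G : Fin 2 → ℕ → Bool,
      (∀ j, {m | G j m = true}.Infinite) ∧ (∀ j m, G j m = true → m ∈ L j) ∧
      ∀ (i : Fin c) (Φ : Fin 2 → Functional), ∃ j,
        (∃ n k, I n = i ∧ 1 ∈ (Φ j).toFun (initSeg (G j) k) n) ∨
          ∃ N, ∀ n k, 1 ∈ (Φ j).toFun (initSeg (G j) k) n → n < N := by
  classical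
  let ι := (Fin c × (Fin 2 → Functional)) ⊕ (Fin 2 × ℕ)
  let _ : Encodable ι := Encodable.ofCountable ι
  let D : ι → Order.Cofinal (Condition L) := fun d =>
    match d with
    | .inl (i, Φ) => ⟨{q | ∃ j, q.Settles I i (Φ j) j}, fun p =>
        let ⟨q, hpq, hq⟩ := exists_settles hI i Φ p
        ⟨q, hq, hpq⟩⟩
    | .inr (j, N) => ⟨{q | ∃ m, N ≤ m ∧ (q.stem j)[m]? = some true}, fun p =>
        let ⟨q, hpq, hq⟩ := hL.exists_stem_mem p j N
        ⟨q, hq, hpq⟩⟩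
  let J := Order.idealOfCofinals p D
  let G : Fin 2 → ℕ → Bool := fun j m => decide (∃ q ∈ J, (q.stem j)[m]? = some true)
  have hG : ∀ q ∈ J, ∀ j m b, (q.stem j)[m]? = some b → G j m = b := by
    intro q hq j m b hb
    cases b with
    | true => exact decide_eq_true ⟨q, hq, hb⟩
    | false =>
      refine decide_eq_false fun ⟨q', hq', h⟩ => ?_
      obtain ⟨r, -, hqr, hqr'⟩ := J.directed q hq q' hq'
      have h1 := (stem_prefix hqr j).getElem?_eq_some hb
      have h2 := (stem_prefix hqr' j).getElem?_eq_some h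
      simp [h1] at h2
  have hstem : ∀ q ∈ J, ∀ j, q.stem j = initSeg (G j) (q.stem j).length := by
    intro q hq j
    refine List.ext_getElem? fun m => ?_
    rw [getElem?_initSeg]
    split_ifs with hm
    · rw [List.getElem?_eq_getElem hm, hG q hq j m _ (List.getElem?_eq_getElem hm)]
    · exact List.getElem?_eq_none (not_lt.1 hm)
  have hlong : ∀ j (N : ℕ), ∃ q ∈ J, ∃ m, N ≤ m ∧ (q.stem j)[m]? = some true := by
    intro j N
    obtain ⟨q, hq, hqJ⟩ := Order.cofinal_meets_idealOfCofinals p D (.inr (j, N))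
    exact ⟨q, hqJ, hq⟩
  refine ⟨G, fun j => ?_, fun j m hm => ?_, fun i Φ => ?_⟩
  · refine Set.infinite_of_not_bddAbove fun ⟨N, hN⟩ => ?_
    obtain ⟨q, hq, m, hm, h⟩ := hlong j (N + 1)
    have := hN (hG q hq j m true h)
    omega
  · obtain ⟨q, -, h⟩ := of_decide_eq_true hm
    exact q.stem_mem j m h
  · obtain ⟨q, ⟨j, hj⟩, hqJ⟩ := Order.cofinal_meets_idealOfCofinals p D (.inl (i, Φ))
    refine ⟨j, ?_⟩
    rcases hj with ⟨n, hi, h1⟩ | ⟨N, hN⟩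
    · exact Or.inl ⟨n, (q.stem j).length, hi, hstem q hqJ j ▸ h1⟩
    · refine Or.inr ⟨N, fun n k h1 => ?_⟩
      -- A later condition has a stem that is long enough for the computation.
      obtain ⟨q', hq', m, hm, h⟩ := hlong j k
      obtain ⟨r, hr, hqr, hqr'⟩ := J.directed q hqJ q' hq'
      obtain ⟨y, hy⟩ := r.nonempty
      obtain ⟨x, hx, -, hxy⟩ := hqr y hy
      refine hN x hx n _ (hxy j) ?_
      rw [hstem r hr j]
      refine (Φ j).mono (initSeg_prefix _ ?_) h1
      have h1 := (List.getElem?_eq_some_iff.1 h).1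
      have h2 := (stem_prefix hqr' j).length_le
      omega

end Condition

theorem charOracle_setOf (g : ℕ → Bool) :
    charOracle {m | g m = true} = fun n => Part.some (g n).toNat := by
  funext n
  by_cases h : g n = true <;> simp [charOracle, h]

theorem one_mem_charOracle {H : Set ℕ} {n : ℕ} : 1 ∈ charOracle H n ↔ n ∈ H := by
  by_cases h : n ∈ H <;> simp [charOracle, h]

/-- If `H 0` and `H 1` are homogeneous, some colour `i` occurs in neither of them; one of two
generic sets does not compute an infinite set without the colour `i`. -/
theorem exists_forall_not_computedBy {I : RT1Instance 3} (hI : I.Generic) {L : Fin 2 → Set ℕ}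
    (p : Condition L) (hL : Condition.Extendable L) :
    ∃ j, ∃ G ⊆ L j, G.Infinite ∧ ∀ H ∈ I.solutions, ¬ H.ComputedBy G := by
  obtain ⟨G, hG₁, hG₂, hG₃⟩ := Condition.exists_generic_sets hI p hL
  by_contra! hcon
  choose H hH hHG using fun j => hcon j {m | G j m = true} (hG₂ j) (hG₁ j)
  have hΦ : ∀ j, ∃ Φ : Functional, Φ.Computes (G j) (charOracle (H j)) := by
    intro j
    refine Functional.exists_computes ?_
    rw [← charOracle_setOf]
    exact RecursiveIn.iff_nat.1 (hHG j)
  choose Φ hΦ using hΦ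
  have hcol : ∀ j, ∃ d, ∀ n ∈ H j, I n = d := by
    intro j
    obtain ⟨n, hn⟩ := (hH j).1.nonempty
    exact ⟨I n, fun m hm => (hH j).2 m hm n hn⟩
  choose d hd using hcol
  have hi : ∀ a b : Fin 3, ∃ i, i ≠ a ∧ i ≠ b := by decide
  obtain ⟨i, hi₀, hi₁⟩ := hi (d 0) (d 1)
  obtain ⟨j, ⟨n, k, hn, h1⟩ | ⟨N, hN⟩⟩ := hG₃ i Φ
  · have hnH : n ∈ H j := one_mem_charOracle.1 ((hΦ j n 1).2 ⟨k, h1⟩)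
    have := hd j n hnH
    fin_cases j
    · exact hi₀ (hn.symm.trans this)
    · exact hi₁ (hn.symm.trans this)
  · refine (hH j).1 ((Set.finite_lt_nat N).subset fun n hn => ?_)
    obtain ⟨k, hk⟩ := (hΦ j n 1).1 (one_mem_charOracle.2 hn)
    exact hN n k hk

/-- For a generic `I` with three colours and any `C` with two colours, some solution of `C` computes
no solution of `I`. -/
theorem RT1Instance.Generic.exists_solution {I : RT1Instance 3} (hI : I.Generic)
    (C : RT1Instance 2) : ∃ G ∈ C.solutions, ∀ H ∈ I.solutions, ¬ H.ComputedBy G := by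
  by_cases hL : Condition.Extendable fun j => {n | C n = j}
  · let p : Condition fun j => {n | C n = j} :=
      { stem := fun _ => []
        cls := {fun _ => 0}
        sym := 0
        start := 0
        isBoundedPiClass := .singleton_zero
        nonempty := Set.singleton_nonempty _
        infinite := by
          rintro _ rfl
          simpa using Set.infinite_univ
        covered := fun _ _ n _ _ => ⟨C n, rfl⟩
        stem_mem := by simp
        start_le := by simp }
    obtain ⟨j, G, hGL, hG, h⟩ := exists_forall_not_computedBy hI p hL
    exact ⟨G, ⟨hG, fun x hx y hy => (hGL hx).trans (hGL hy).symm⟩, h⟩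
  · -- All reservoirs of some condition `q` are, from `N` on, of the colour other than `j`. Force
    -- below it, with both sets of this colour.
    simp only [Condition.Extendable, Set.mem_ofPred_eq] at hL
    push Not at hL
    obtain ⟨q, j, N, hq⟩ := hL
    let L : Fin 2 → Set ℕ := fun _ => {n | C n ≠ j}
    let p : Condition L :=
      { stem := fun _ => List.replicate N false
        cls := q.cls
        sym := q.sym
        start := N
        isBoundedPiClass := q.isBoundedPiClass
        nonempty := q.nonempty
        infinite := q.infinite
        covered := fun x hx n hn hxn => ⟨0, hq x hx n hn hxn⟩
        stem_mem := by
          intro _ m h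
          rw [List.getElem?_replicate] at h
          split_ifs at h
          simp at h
        start_le := by simp }
    have hL' : Condition.Extendable L := by
      intro r i M
      obtain ⟨x, hx⟩ := r.nonempty
      obtain ⟨m, hm, hM⟩ := (r.infinite x hx).exists_gt (max M r.start)
      obtain ⟨_, hmL⟩ := r.covered x hx m ((le_max_right _ _).trans hM.le) hm
      exact ⟨x, hx, m, (le_max_left _ _).trans hM.le, hm, hmL⟩
    obtain ⟨_, G, hGL, hG, h⟩ := exists_forall_not_computedBy hI p hL'
    refine ⟨G, ⟨hG, fun x hx y hy => ?_⟩, h⟩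
    have hx' : C x ≠ j := hGL hx
    have hy' : C y ≠ j := hGL hy
    omega

theorem mainTheorem2 :
    ∃ I : RT1Instance 3, I.ZeroJumpComputable ∧
      (∀ C : RT1Instance 2, ∃ G ∈ C.solutions, ∀ H ∈ I.solutions, ¬ H.ComputedBy G) ∧
      (∀ C : RT1Instance 2, ¬ MuchnikReducible I.solutions C.solutions) := by
  obtain ⟨I, hI₀, hI⟩ := exists_generic_zeroJumpComputable 3
  refine ⟨I, hI₀, hI.exists_solution, fun C hC => ?_⟩
  obtain ⟨G, hG, h⟩ := hI.exists_solution C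
  obtain ⟨H, hH, hHG⟩ := hC G hG
  exact h H hH hHG
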